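/- Let $k,\ell\ge 1$, $p=k+\ell$, $\alpha\in(0,1)$ and $\lambda>0$. Let $(X_i,Y_i)_{i\ge1}$ be random vectors in $\mathbb{R}^k\times\mathbb{R}^\ell$ on a common probability space, let $\widehat f:\mathbb{R}^k\to\mathbb{R}^\ell$ be a deterministic predictor, and put $R_i=Y_i-\widehat f(X_i)$ and $V_i=(X_i^\top\ R_i^\top)^\top\in\mathbb{R}^p$. For $n\ge 1$ put $n_\alpha=\lceil(1-\alpha)(n+1)\rceil$, and for an $n$-tuple $a$ let $a_{(1)}\le\dots\le a_{(n)}$ denote its order statistics. Only $n$ with $\alpha>1/(n+1)$, i.e. $n_\alpha\le n$, are considered; this holds for all large $n$. *Exact conformal set.* For $z\in\mathbb{R}^\ell$ let $\mathbf V(z)$ be the $(n+1)\times p$ matrix with rows $V_1^\top,\dots,V_n^\top,(X_{n+1}^\top\ z^\top)$, let $\mathbf W(z)=\big(\mathbf I-\tfrac1{n+1}\mathbb 1\mathbb 1^\top\big)\mathbf V(z)$ have rows $W_i(z)^\top$, and set $\widehat{\mathbf\Sigma}_\lambda(z)=\frac1n\mathbf W(z)^\top\mathbf W(z)+\lambda\mathbf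 I$ and $S_i(z)=W_i(z)^\top\widehat{\mathbf\Sigma}_\lambda(z)^{-1}W_i(z)$ for $1\le i\le n+1$. Then $$\mathcal C_\alpha^n=\{z\in\mathbb{R}^\ell: S_{n+1}(z)\le S_{(n_\alpha)}(z)\},$$ where $S_{(n_\alpha)}(z)$ is the $n_\alpha$-th order statistic of $(S_1(z),\dots,S_n(z))$. *Conservative ellipsoid.* Let $\mathbf B_n$ be the $n\times p$ matrix with rows $(V_i-\frac1n\sum_{s=1}^nV_s)^\top$, let $\widehat{\mathbf\Sigma}_{n,\lambda}=\frac1n\mathbf B_n^\top\mathbf B_n+\lambda\mathbf I$, with blocks $\mathbf\Sigma^{11},\mathbf\Sigma^{12},\mathbf\Sigma^{21},\mathbf\Sigma^{22}$ for the decomposition $p=k+\ell$, and let $q_{n,\alpha}=n\,p_{(n_\alpha)}$, where $p_{(n_\alpha)}$ is the $n_\alpha$-th order statistic of the $n$ diagonal entries of $\mathbf B_n(\mathbf B_n^\top\mathbf B_n+n\lambda\mathbf I)^{-1}\mathbf B_n^\top$. Put $\overline X_n=\frac1n\sum_{i=1}^nX_i$, $\overline R_n=\frac1n\sum_{i=1}^nR_i$,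 $X^{\mathrm c}_{n+1}=X_{n+1}-\overline X_n$ and $$\mathcal A_n=\mathbf\Sigma^{22}-\mathbf\Sigma^{21}(\mathbf\Sigma^{11})^{-1}\mathbf\Sigma^{12},\qquad Z_0^n=\mathbf\Sigma^{21}(\mathbf\Sigma^{11})^{-1}X^{\mathrm c}_{n+1}+\overline R_n,$$ $$\rho_{n,\alpha}=\frac{q_{n,\alpha}+1}{1-(q_{n,\alpha}+1)/n}-1-(X^{\mathrm c}_{n+1})^\top(\mathbf\Sigma^{11})^{-1}X^{\mathrm c}_{n+1}.$$ Then $\mathcal E_\alpha^n=\mathbb{R}^\ell$ if $q_{n,\alpha}\ge n-1$, and otherwise $$\mathcal E_\alpha^n=\{z\in\mathbb{R}^\ell:(z-Z_0^n)^\top\mathcal A_n^{-1}(z-Z_0^n)\le\rho_{n,\alpha}\}.$$ **Proposition.** Assume that the vectors $V_i$ are iid and that $\mathbb E[\|V_1\|^{4q}]<\infty$ for some real $q>1$. Then for every compact set $K\subset\mathbb{R}^\ell$, $$\mathrm{Vol}\big((\mathcal E_\alpha^n\setminus\mathcal C_\alpha^n)\cap K\big)\longrightarrow 0\quad\text{in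 probability as } n\to\infty,$$ where $\mathrm{Vol}$ is Lebesgue measure on $\mathbb{R}^\ell$. -/

import Mathlib

open MeasureTheory ProbabilityTheory Filter

noncomputable section

namespace ConformalEllipsoid

/-- The `m`-th order statistic `a_(m)` (with `1 ≤ m ≤ n`) of the `n`-tuple `a`: the `m`-th entry of
the tuple rearranged in nondecreasing order. The value `0` for `m` outside `1, …, n`, where there
is no such order statistic, is a placeholder. -/
def orderStat {n : ℕ} (a : Fin n → ℝ) (m : ℕ) : ℝ :=
  if h : 1 ≤ m ∧ m ≤ n then a (Tuple.sort a ⟨m - 1, by omega⟩) else 0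

/-- The rank `n_α = ⌈(1 - α) (n + 1)⌉`. -/
def confRank (n : ℕ) (α : ℝ) : ℕ := ⌈(1 - α) * ((n : ℝ) + 1)⌉₊

variable {k l : ℕ}

/-- The column vector `(x, r)` of dimension `p = k + l`; its coordinates are indexed by
`Fin k ⊕ Fin l`, and its norm is the Euclidean one. -/
def stack (x : EuclideanSpace ℝ (Fin k)) (r : EuclideanSpace ℝ (Fin l)) :
    EuclideanSpace ℝ (Fin k ⊕ Fin l) :=
  WithLp.toLp 2 (Sum.elim x.ofLp r.ofLp)

/-! In the definitions below the data are two sequences `x`, `r` (inputs and residuals), with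
indices starting at `0`: the calibration sample of size `n` consists of the pairs
`(x 0, r 0), …, (x (n - 1), r (n - 1))`, and the new input is `x n`. The residual `r n` of the new
point is never used; its place is taken by the candidate value `z`. -/

section Score

/-- The matrix `V(z)` with `n + 1` rows: the vectors `(x i, r i)`, `i < n`, followed by the guess
`(x n, z)`. -/
def dataMatrix (n : ℕ) (x : ℕ → EuclideanSpace ℝ (Fin k)) (r : ℕ → EuclideanSpace ℝ (Fin l))
    (z : EuclideanSpace ℝ (Fin l)) : Matrix (Fin (n + 1)) (Fin k ⊕ Fin l) ℝ :=
  Matrix.of fun i j => stack (x i) (if (i : ℕ) < n then r i else z) j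

/-- The orthogonal projector of `ℝ^m` onto the orthogonal complement of the all-ones vector. -/
def centering (m : ℕ) : Matrix (Fin m) (Fin m) ℝ :=
  1 - (m : ℝ)⁻¹ • Matrix.of fun _ _ => (1 : ℝ)

/-- The empirically centred data matrix `W(z)`. -/
def centeredData (n : ℕ) (x : ℕ → EuclideanSpace ℝ (Fin k)) (r : ℕ → EuclideanSpace ℝ (Fin l))
    (z : EuclideanSpace ℝ (Fin l)) : Matrix (Fin (n + 1)) (Fin k ⊕ Fin l) ℝ :=
  centering (n + 1) * dataMatrix n x r z

/-- The ridge empirical covariance matrix `n⁻¹ W(z)ᵀ W(z) + lam I`. -/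
def ridgeCov (n : ℕ) (lam : ℝ) (x : ℕ → EuclideanSpace ℝ (Fin k))
    (r : ℕ → EuclideanSpace ℝ (Fin l)) (z : EuclideanSpace ℝ (Fin l)) :
    Matrix (Fin k ⊕ Fin l) (Fin k ⊕ Fin l) ℝ :=
  (n : ℝ)⁻¹ • ((centeredData n x r z).transpose * centeredData n x r z) + lam • 1

/-- The Mahalanobis score of the `i`-th row of `W(z)`. -/
def score (n : ℕ) (lam : ℝ) (x : ℕ → EuclideanSpace ℝ (Fin k))
    (r : ℕ → EuclideanSpace ℝ (Fin l)) (z : EuclideanSpace ℝ (Fin l)) (i : Fin (n + 1)) : ℝ :=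
  dotProduct (centeredData n x r z i)
    (((ridgeCov n lam x r z)⁻¹).mulVec (centeredData n x r z i))

/-- The exact conformal set: the candidates `z` whose score is at most the order statistic of
rank `n_α` of the scores of the `n` calibration points (these scores depend on `z` too). -/
def conformalSet (n : ℕ) (α lam : ℝ) (x : ℕ → EuclideanSpace ℝ (Fin k))
    (r : ℕ → EuclideanSpace ℝ (Fin l)) : Set (EuclideanSpace ℝ (Fin l)) :=
  {z | score n lam x r z (Fin.last n) ≤
    orderStat (fun i : Fin n => score n lam x r z i.castSucc) (confRank n α)}

end Score

section Ellipsoid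

/-- The matrix `B_n` whose rows are the calibration vectors minus their empirical mean. -/
def calibMatrix (n : ℕ) (x : ℕ → EuclideanSpace ℝ (Fin k)) (r : ℕ → EuclideanSpace ℝ (Fin l)) :
    Matrix (Fin n) (Fin k ⊕ Fin l) ℝ :=
  Matrix.of fun i j => stack (x i) (r i) j - (n : ℝ)⁻¹ * ∑ s : Fin n, stack (x s) (r s) j

/-- The ridge empirical covariance matrix `n⁻¹ B_nᵀ B_n + lam I` of the calibration sample. -/
def calibCov (n : ℕ) (lam : ℝ) (x : ℕ → EuclideanSpace ℝ (Fin k))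
    (r : ℕ → EuclideanSpace ℝ (Fin l)) : Matrix (Fin k ⊕ Fin l) (Fin k ⊕ Fin l) ℝ :=
  (n : ℝ)⁻¹ • ((calibMatrix n x r).transpose * calibMatrix n x r) + lam • 1

/-- The regularized projector `B_n (B_nᵀ B_n + n lam I)⁻¹ B_nᵀ`. -/
def ridgeProj (n : ℕ) (lam : ℝ) (x : ℕ → EuclideanSpace ℝ (Fin k))
    (r : ℕ → EuclideanSpace ℝ (Fin l)) : Matrix (Fin n) (Fin n) ℝ :=
  calibMatrix n x r *
    ((calibMatrix n x r).transpose * calibMatrix n x r + ((n : ℝ) * lam) • 1)⁻¹ *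
    (calibMatrix n x r).transpose

/-- `q_{n,α}`: `n` times the order statistic of rank `n_α` of the diagonal of `ridgeProj`. -/
def qStat (n : ℕ) (α lam : ℝ) (x : ℕ → EuclideanSpace ℝ (Fin k))
    (r : ℕ → EuclideanSpace ℝ (Fin l)) : ℝ :=
  (n : ℝ) * orderStat (fun i : Fin n => ridgeProj n lam x r i i) (confRank n α)

/-- The empirical mean of `u 0, …, u (n - 1)`. -/
def empMean {d : ℕ} (n : ℕ) (u : ℕ → EuclideanSpace ℝ (Fin d)) : EuclideanSpace ℝ (Fin d) :=
  (n : ℝ)⁻¹ • ∑ i : Fin n, u i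

/-- The new input centred by the calibration mean. -/
def newInput (n : ℕ) (x : ℕ → EuclideanSpace ℝ (Fin k)) : Fin k → ℝ :=
  (x n - empMean n x).ofLp

/-- The shape matrix of the ellipsoid: the Schur complement of the `k × k` block of `calibCov`. -/
def shape (n : ℕ) (lam : ℝ) (x : ℕ → EuclideanSpace ℝ (Fin k))
    (r : ℕ → EuclideanSpace ℝ (Fin l)) : Matrix (Fin l) (Fin l) ℝ :=
  (calibCov n lam x r).toBlocks₂₂ -
    (calibCov n lam x r).toBlocks₂₁ * ((calibCov n lam x r).toBlocks₁₁)⁻¹ *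
      (calibCov n lam x r).toBlocks₁₂

/-- The centre `Z_0^n` of the ellipsoid. -/
def center (n : ℕ) (lam : ℝ) (x : ℕ → EuclideanSpace ℝ (Fin k))
    (r : ℕ → EuclideanSpace ℝ (Fin l)) : Fin l → ℝ :=
  ((calibCov n lam x r).toBlocks₂₁ * ((calibCov n lam x r).toBlocks₁₁)⁻¹).mulVec (newInput n x) +
    (empMean n r).ofLp

/-- The squared radius `ρ_{n,α}` of the ellipsoid; it may be negative. -/
def sqRadius (n : ℕ) (α lam : ℝ) (x : ℕ → EuclideanSpace ℝ (Fin k))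
    (r : ℕ → EuclideanSpace ℝ (Fin l)) : ℝ :=
  (qStat n α lam x r + 1) / (1 - (qStat n α lam x r + 1) / n) - 1 -
    dotProduct (newInput n x) ((((calibCov n lam x r).toBlocks₁₁)⁻¹).mulVec (newInput n x))

open Classical in
/-- The conservative ellipsoid: the whole space if `q_{n,α} ≥ n - 1`, and otherwise the set of `z`
with `(z - Z_0^n)ᵀ A_n⁻¹ (z - Z_0^n) ≤ ρ_{n,α}`, where `A_n` is the shape matrix. -/
def ellipsoid (n : ℕ) (α lam : ℝ) (x : ℕ → EuclideanSpace ℝ (Fin k))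
    (r : ℕ → EuclideanSpace ℝ (Fin l)) : Set (EuclideanSpace ℝ (Fin l)) :=
  if (n : ℝ) - 1 ≤ qStat n α lam x r then Set.univ
  else {z | dotProduct (z.ofLp - center n lam x r)
    (((shape n lam x r)⁻¹).mulVec (z.ofLp - center n lam x r)) ≤ sqRadius n α lam x r}

end Ellipsoid

end ConformalEllipsoid

end

/-! Let `m(z)` be the squared norm of the new point, centred by the calibration mean, for the
inverse of `calibCov`. Write `q` for `qStat`. Outside the conformal set `q < m(z)`; inside the
ellipsoid `m(z) ≤ (q + 1) / (1 - (q + 1) / n) - 1`. The leverages sum to at most `p = k + l`, and a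
fraction of order `α` of them is at least `q / n`, so `q ≤ 2 p / α` whatever the sample, and the two
bounds on `m` differ by `O(1 / n)`.

By the Schur complement, `m(z)` is a quadratic form `Q` in `z - center` plus a constant, so the
difference set lies in a shell `t < Q ≤ t + δ` with `δ = O(1 / n)`. Its volume is `O(√δ)` times that
of a ball of squared radius `τ`, the empirical second moment plus `lam`. Markov's inequality bounds
`τ` in probability.

The inequality `q < m(z)` comes from a calibration row with leverage at least `q / n` and score
below that of the new point. Centring at the augmented mean shifts rows along the new point, and the
augmented covariance adds a rank one term in the same direction; `quadForm_lt_of_sub_smul_lt` and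
`inv_quadForm_lt_of_rank_one` undo these two effects. -/

namespace ConformalEllipsoid

open Matrix

/-! ### Order statistics -/

section OrderStat

variable {n : ℕ}

/-- An order statistic of one tuple and the order statistic of the same rank of another tuple are
compared at a common index. -/
theorem exists_orderStat_le_and_le_orderStat (a b : Fin n → ℝ) {m : ℕ} (h1 : 1 ≤ m) (h2 : m ≤ n) :
    ∃ i, orderStat a m ≤ a i ∧ b i ≤ orderStat b m := by
  have hm : 1 ≤ m ∧ m ≤ n := ⟨h1, h2⟩
  let j : Fin n := ⟨m - 1, by omega⟩
  let s : Finset (Fin n) := (Finset.Ici j).map (Tuple.sort a).toEmbedding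
  let t : Finset (Fin n) := (Finset.Iic j).map (Tuple.sort b).toEmbedding
  -- Pigeonhole: `s` has `n - m + 1` elements and `t` has `m`, one too many to be disjoint.
  have hst : ¬ Disjoint s t := by
    intro hd
    have h := Finset.card_le_univ (s ∪ t)
    rw [Finset.card_union_of_disjoint hd] at h
    simp only [s, t, Finset.card_map, Fin.card_Ici, Fin.card_Iic, Fintype.card_fin, j] at h
    omega
  obtain ⟨i, his, hit⟩ := Finset.not_disjoint_iff.mp hst
  simp only [s, t, Finset.mem_map, Finset.mem_Ici, Finset.mem_Iic, Equiv.coe_toEmbedding] at his hit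
  obtain ⟨u, hu, rfl⟩ := his
  obtain ⟨v, hv, hvu⟩ := hit
  refine ⟨Tuple.sort a u, ?_, ?_⟩
  · rw [orderStat, dif_pos hm]
    exact Tuple.monotone_sort a hu
  · rw [orderStat, dif_pos hm, ← hvu]
    exact Tuple.monotone_sort b hv

theorem orderStat_nonneg {a : Fin n → ℝ} (ha : ∀ i, 0 ≤ a i) (m : ℕ) : 0 ≤ orderStat a m := by
  unfold orderStat
  split_ifs
  · exact ha _
  · exact le_rfl

/-- The `n - m + 1` entries of rank at least `m` all dominate the order statistic, and the others
are nonnegative. -/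
theorem orderStat_mul_le_sum {a : Fin n → ℝ} (ha : ∀ i, 0 ≤ a i) {m : ℕ} (h1 : 1 ≤ m)
    (h2 : m ≤ n) : ((n : ℝ) - m + 1) * orderStat a m ≤ ∑ i, a i := by
  have hm : 1 ≤ m ∧ m ≤ n := ⟨h1, h2⟩
  let j : Fin n := ⟨m - 1, by omega⟩
  have hcard : ((Finset.Ici j).card : ℝ) = (n : ℝ) - m + 1 := by
    rw [Fin.card_Ici]
    have : n - (j : ℕ) + m = n + 1 := by simp only [j]; omega
    have h : ((n - (j : ℕ) : ℕ) : ℝ) + m = n + 1 := by exact_mod_cast this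
    linarith
  rw [← Equiv.sum_comp (Tuple.sort a) a, ← hcard, ← nsmul_eq_mul]
  refine le_trans ?_ (Finset.sum_le_sum_of_subset_of_nonneg (Finset.subset_univ (Finset.Ici j))
    fun i _ _ => ha _)
  refine Finset.card_nsmul_le_sum _ _ _ fun i hi => ?_
  rw [orderStat, dif_pos hm]
  exact Tuple.monotone_sort a (Finset.mem_Ici.mp hi)

end OrderStat

/-! ### Quadratic forms of inverse matrices -/

section QuadForm

variable {ι : Type*} [Fintype ι]

theorem dotProduct_mulVec_comm {T : Matrix ι ι ℝ} (hT : T.IsHermitian) (x y : ι → ℝ) :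
    x ⬝ᵥ (T *ᵥ y) = y ⬝ᵥ (T *ᵥ x) := by
  have h : Tᵀ = T := by rw [← conjTranspose_eq_transpose_of_trivial]; exact hT
  rw [dotProduct_comm, ← vecMul_transpose, h, ← dotProduct_mulVec]

theorem quadForm_nonneg {T : Matrix ι ι ℝ} (hT : T.PosSemidef) (x : ι → ℝ) :
    0 ≤ x ⬝ᵥ (T *ᵥ x) := by
  simpa using hT.dotProduct_mulVec_nonneg x

theorem quadForm_sub_smul {T : Matrix ι ι ℝ} (hT : T.IsHermitian) (x y : ι → ℝ) (c : ℝ) :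
    (x - c • y) ⬝ᵥ (T *ᵥ (x - c • y)) =
      x ⬝ᵥ (T *ᵥ x) - 2 * c * (y ⬝ᵥ (T *ᵥ x)) + c ^ 2 * (y ⬝ᵥ (T *ᵥ y)) := by
  simp only [mulVec_sub, mulVec_smul, sub_dotProduct, dotProduct_sub, smul_dotProduct,
    dotProduct_smul, smul_eq_mul, dotProduct_mulVec_comm hT x y]
  ring

/-- The Cauchy–Schwarz inequality for a positive semidefinite matrix. -/
theorem sq_dotProduct_mulVec_le {T : Matrix ι ι ℝ} (hT : T.PosSemidef) (x y : ι → ℝ) :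
    (y ⬝ᵥ (T *ᵥ x)) ^ 2 ≤ (y ⬝ᵥ (T *ᵥ y)) * (x ⬝ᵥ (T *ᵥ x)) := by
  have h : ∀ c : ℝ, 0 ≤ (y ⬝ᵥ (T *ᵥ y)) * (c * c) + (-2 * (y ⬝ᵥ (T *ᵥ x))) * c +
      x ⬝ᵥ (T *ᵥ x) := by
    intro c
    have := quadForm_nonneg hT (x - c • y)
    rw [quadForm_sub_smul hT.isHermitian] at this
    linarith
  have := discrim_le_zero h
  rw [discrim] at this
  linarith

/-- A triangle inequality: if `x - c y` is shorter than `(1 - c) y`, then `x` is shorter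
than `y`. -/
theorem quadForm_lt_of_sub_smul_lt {T : Matrix ι ι ℝ} (hT : T.PosSemidef) (x y : ι → ℝ) {c : ℝ}
    (hc0 : 0 ≤ c) (hc1 : c < 1)
    (h : (x - c • y) ⬝ᵥ (T *ᵥ (x - c • y)) < (1 - c) ^ 2 * (y ⬝ᵥ (T *ᵥ y))) :
    x ⬝ᵥ (T *ᵥ x) < y ⬝ᵥ (T *ᵥ y) := by
  rw [quadForm_sub_smul hT.isHermitian] at h
  have h2 := quadForm_nonneg hT (x - (1 : ℝ) • y)
  rw [quadForm_sub_smul hT.isHermitian] at h2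
  -- The bound `2⟨y, x⟩ ≤ ‖x‖² + ‖y‖²`, multiplied by `c`, removes the cross term and leaves `(1 -
  -- c) ‖x‖² < (1 - c) ‖y‖²`.
  have h3 := mul_nonneg hc0 h2
  nlinarith

variable [DecidableEq ι]

/-- Removing a nonnegative multiple of `y yᵀ` from a positive definite matrix preserves the
property that `x` is shorter than `y` for the inverse matrix. -/
theorem inv_quadForm_lt_of_rank_one {S T : Matrix ι ι ℝ} (hS : S.PosDef) (hT : T.PosDef)
    (x y : ι → ℝ) {c : ℝ} (hc : 0 ≤ c) (hST : T = S + c • vecMulVec y y)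
    (h : x ⬝ᵥ (T⁻¹ *ᵥ x) < y ⬝ᵥ (T⁻¹ *ᵥ y)) : x ⬝ᵥ (S⁻¹ *ᵥ x) < y ⬝ᵥ (S⁻¹ *ᵥ y) := by
  have hSdet : IsUnit S.det := (isUnit_iff_isUnit_det S).mp hS.isUnit
  have hTdet : IsUnit T.det := (isUnit_iff_isUnit_det T).mp hT.isUnit
  -- Sherman–Morrison, with the coefficient left in terms of `T⁻¹`.
  have hinv : ∀ u : ι → ℝ, T⁻¹ *ᵥ u = S⁻¹ *ᵥ u - (c * (y ⬝ᵥ (T⁻¹ *ᵥ u))) • (S⁻¹ *ᵥ y) := by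
    intro u
    have h1 : S *ᵥ (T⁻¹ *ᵥ u) = u - (c * (y ⬝ᵥ (T⁻¹ *ᵥ u))) • y := by
      have h2 : T *ᵥ (T⁻¹ *ᵥ u) = u := by rw [mulVec_mulVec, mul_nonsing_inv _ hTdet, one_mulVec]
      have h3 : vecMulVec y y *ᵥ (T⁻¹ *ᵥ u) = (y ⬝ᵥ (T⁻¹ *ᵥ u)) • y := by
        rw [vecMulVec_mulVec]; ext i; simp [mul_comm]
      nth_rewrite 1 [hST] at h2
      rw [add_mulVec, smul_mulVec, h3, smul_smul] at h2
      exact eq_sub_of_add_eq h2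
    calc T⁻¹ *ᵥ u = S⁻¹ *ᵥ (S *ᵥ (T⁻¹ *ᵥ u)) := by
          rw [mulVec_mulVec _ S⁻¹ S, nonsing_inv_mul _ hSdet, one_mulVec]
      _ = _ := by rw [h1, mulVec_sub, mulVec_smul]
  have hT0 := hT.inv.posSemidef
  have hxx := congrArg (fun w => x ⬝ᵥ w) (hinv x)
  have hyx := congrArg (fun w => y ⬝ᵥ w) (hinv x)
  have hyy := congrArg (fun w => y ⬝ᵥ w) (hinv y)
  simp only [dotProduct_sub, dotProduct_smul, smul_eq_mul] at hxx hyx hyy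
  have hs := dotProduct_mulVec_comm hS.inv.isHermitian x y
  have hcs := sq_dotProduct_mulVec_le hS.inv.posSemidef x y
  have hm0 := quadForm_nonneg hS.inv.posSemidef y
  have ht0 := quadForm_nonneg hT0 x
  rw [hs] at hxx
  generalize x ⬝ᵥ (T⁻¹ *ᵥ x) = t at *
  generalize y ⬝ᵥ (T⁻¹ *ᵥ y) = s at *
  generalize y ⬝ᵥ (T⁻¹ *ᵥ x) = r at *
  generalize x ⬝ᵥ (S⁻¹ *ᵥ x) = a at *
  generalize y ⬝ᵥ (S⁻¹ *ᵥ y) = m at *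
  generalize y ⬝ᵥ (S⁻¹ *ᵥ x) = b at *
  -- Multiplied by `1 + c m`, the hypothesis `t < s` reads `a (1 + c m) - c b² < m`; Cauchy–Schwarz
  -- `b² ≤ m a` then gives `a < m`.
  have hk : 0 < 1 + c * m := by positivity
  have hs' : s * (1 + c * m) = m := by linarith
  have hr' : r * (1 + c * m) = b := by linarith
  have ht' : t * (1 + c * m) = a * (1 + c * m) - c * b ^ 2 := by
    rw [hxx]; linear_combination (-c * b) * hr'
  have h1 : t * (1 + c * m) < m := (mul_lt_mul_of_pos_right h hk).trans_eq hs'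
  have h2 : c * b ^ 2 ≤ c * (m * a) := mul_le_mul_of_nonneg_left hcs hc
  linarith

/-- If `S ≤ τ` then `S⁻¹ ≥ τ⁻¹`. -/
theorem dotProduct_self_le_mul_inv_quadForm {S : Matrix ι ι ℝ} (hS : S.PosDef) {τ : ℝ}
    (hτ : ∀ x : ι → ℝ, x ⬝ᵥ (S *ᵥ x) ≤ τ * (x ⬝ᵥ x)) (x : ι → ℝ) :
    x ⬝ᵥ x ≤ τ * (x ⬝ᵥ (S⁻¹ *ᵥ x)) := by
  have hSdet : IsUnit S.det := (isUnit_iff_isUnit_det S).mp hS.isUnit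
  -- Cauchy–Schwarz for `S` between `x` and `S⁻¹ x`: `(x ⬝ᵥ x)² ≤ (x ⬝ᵥ S x) (x ⬝ᵥ S⁻¹ x)`.
  have h1 := sq_dotProduct_mulVec_le hS.posSemidef (S⁻¹ *ᵥ x) x
  have h2 : S *ᵥ (S⁻¹ *ᵥ x) = x := by rw [mulVec_mulVec, mul_nonsing_inv _ hSdet, one_mulVec]
  have h0 := quadForm_nonneg hS.inv.posSemidef x
  rw [h2, dotProduct_comm (S⁻¹ *ᵥ x) x] at h1
  have h3 := mul_le_mul_of_nonneg_right (hτ x) h0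
  have h4 : 0 ≤ x ⬝ᵥ x := by simpa using dotProduct_star_self_nonneg x
  rcases h4.eq_or_lt with h5 | h5
  · rw [← h5]
    rw [dotProduct_self_eq_zero.mp h5.symm]
    simp
  · nlinarith

end QuadForm

/-- The quadratic form of the inverse of a block matrix through the Schur complement of its
first block. -/
theorem inv_quadForm_sumElim {ι κ : Type*} [Fintype ι] [Fintype κ] [DecidableEq ι] [DecidableEq κ]
    {S : Matrix (ι ⊕ κ) (ι ⊕ κ) ℝ} (hS : S.PosDef) (x : ι → ℝ) (u : κ → ℝ) :
    Sum.elim x u ⬝ᵥ (S⁻¹ *ᵥ Sum.elim x u) =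
      (u - (S.toBlocks₂₁ * S.toBlocks₁₁⁻¹) *ᵥ x) ⬝ᵥ
        ((S.toBlocks₂₂ - S.toBlocks₂₁ * S.toBlocks₁₁⁻¹ * S.toBlocks₁₂)⁻¹ *ᵥ
          (u - (S.toBlocks₂₁ * S.toBlocks₁₁⁻¹) *ᵥ x)) + x ⬝ᵥ (S.toBlocks₁₁⁻¹ *ᵥ x) := by
  have hSdet : IsUnit S.det := (isUnit_iff_isUnit_det S).mp hS.isUnit
  have hA : S.toBlocks₁₁.PosDef := hS.submatrix (e := Sum.inl) Sum.inl_injective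
  have hAdet : IsUnit S.toBlocks₁₁.det := (isUnit_iff_isUnit_det _).mp hA.isUnit
  have hsymm : S.toBlocks₁₂ = S.toBlocks₂₁ᵀ := by
    ext i j
    simpa [toBlocks₁₂, toBlocks₂₁] using (hS.isHermitian.apply (Sum.inl i) (Sum.inr j)).symm
  set A := S.toBlocks₁₁
  set C := S.toBlocks₂₁
  set D := S.toBlocks₂₂
  have hSb : S = fromBlocks A Cᵀ C D := by rw [← hsymm]; exact (fromBlocks_toBlocks S).symm
  rw [hsymm]
  have hDdet : IsUnit (D - C * A⁻¹ * Cᵀ).det := by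
    let := invertibleOfIsUnitDet A hAdet
    rw [hSb, det_fromBlocks₁₁, invOf_eq_nonsing_inv] at hSdet
    exact isUnit_of_mul_isUnit_right hSdet
  set E := D - C * A⁻¹ * Cᵀ
  set d := u - (C * A⁻¹) *ᵥ x with hd
  set w := E⁻¹ *ᵥ d
  have hEw : E *ᵥ w = d := by rw [mulVec_mulVec, mul_nonsing_inv _ hDdet, one_mulVec]
  have hAm : ∀ y, A *ᵥ (A⁻¹ *ᵥ y) = y := fun y => by
    rw [mulVec_mulVec, mul_nonsing_inv _ hAdet, one_mulVec]
  -- Block elimination: the second component of the solution is the Schur complement inverse applied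
  -- to `d`.
  have hsol : S⁻¹ *ᵥ Sum.elim x u = Sum.elim (A⁻¹ *ᵥ (x - Cᵀ *ᵥ w)) w := by
    have h : S *ᵥ Sum.elim (A⁻¹ *ᵥ (x - Cᵀ *ᵥ w)) w = Sum.elim x u := by
      rw [hSb, fromBlocks_mulVec]
      congr 1
      · simp only [Sum.elim_comp_inl, Sum.elim_comp_inr]
        rw [hAm, sub_add_cancel]
      · simp only [Sum.elim_comp_inl, Sum.elim_comp_inr]
        have h1 : D *ᵥ w - C *ᵥ (A⁻¹ *ᵥ (Cᵀ *ᵥ w)) = u - C *ᵥ (A⁻¹ *ᵥ x) := by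
          rw [mulVec_mulVec _ A⁻¹, mulVec_mulVec _ C, ← Matrix.mul_assoc, ← sub_mulVec, hEw, hd,
            ← mulVec_mulVec]
        rw [mulVec_sub, mulVec_sub]
        rw [sub_eq_iff_eq_add] at h1
        rw [h1]
        abel
    rw [← h, mulVec_mulVec, nonsing_inv_mul _ hSdet, one_mulVec]
  rw [hsol, sumElim_dotProduct_sumElim, mulVec_sub, dotProduct_sub, hd, sub_dotProduct]
  have h1 : x ⬝ᵥ (A⁻¹ *ᵥ (Cᵀ *ᵥ w)) = ((C * A⁻¹) *ᵥ x) ⬝ᵥ w := by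
    rw [dotProduct_mulVec_comm hA.inv.isHermitian, ← mulVec_mulVec, dotProduct_comm (C *ᵥ _) w,
      dotProduct_mulVec w C, ← mulVec_transpose]
  rw [h1]
  ring

/-! ### The sample covariance matrices -/

section Sample

variable {k l : ℕ} (n : ℕ) (x : ℕ → EuclideanSpace ℝ (Fin k)) (r : ℕ → EuclideanSpace ℝ (Fin l))

/-- The new point `(x n, z)` centred by the calibration mean. -/
noncomputable def newPoint (z : EuclideanSpace ℝ (Fin l)) : Fin k ⊕ Fin l → ℝ :=
  fun j => stack (x n) z j - (n : ℝ)⁻¹ * ∑ s : Fin n, stack (x s) (r s) j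

theorem newPoint_eq_sumElim (z : EuclideanSpace ℝ (Fin l)) :
    newPoint n x r z = Sum.elim (newInput n x) (z.ofLp - (empMean n r).ofLp) := by
  ext j
  rcases j with j | j <;> simp [newPoint, stack, newInput, empMean]

theorem sum_calibMatrix (j : Fin k ⊕ Fin l) : ∑ i, calibMatrix n x r i j = 0 := by
  rcases Nat.eq_zero_or_pos n with rfl | hn
  · simp
  · have : (n : ℝ) ≠ 0 := by positivity
    simp [calibMatrix, Finset.sum_sub_distrib, this]

theorem centeredData_apply (z : EuclideanSpace ℝ (Fin l)) (i : Fin (n + 1)) (j : Fin k ⊕ Fin l) :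
    centeredData n x r z i j = dataMatrix n x r z i j -
      ((n : ℝ) + 1)⁻¹ * (∑ s : Fin n, stack (x s) (r s) j + stack (x n) z j) := by
  have h : ∑ s, dataMatrix n x r z s j = ∑ s : Fin n, stack (x s) (r s) j + stack (x n) z j := by
    simp [Fin.sum_univ_castSucc, dataMatrix]
  rw [← h, centeredData, centering, Matrix.sub_mul, Matrix.one_mul, Matrix.smul_mul]
  simp [Matrix.mul_apply]

variable {n}

theorem centeredData_castSucc (hn : 0 < n) (z : EuclideanSpace ℝ (Fin l)) (i : Fin n) :
    centeredData n x r z i.castSucc =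
      calibMatrix n x r i - ((n : ℝ) + 1)⁻¹ • newPoint n x r z := by
  have hn' : (n : ℝ) ≠ 0 := by positivity
  have hn1 : (n : ℝ) + 1 ≠ 0 := by positivity
  ext j
  rw [centeredData_apply]
  simp only [dataMatrix, calibMatrix, newPoint, Matrix.of_apply, Fin.val_castSucc, i.isLt, if_true,
    Pi.sub_apply, Pi.smul_apply, smul_eq_mul]
  field_simp
  ring

theorem centeredData_last (hn : 0 < n) (z : EuclideanSpace ℝ (Fin l)) :
    centeredData n x r z (Fin.last n) = (1 - ((n : ℝ) + 1)⁻¹) • newPoint n x r z := by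
  have hn' : (n : ℝ) ≠ 0 := by positivity
  have hn1 : (n : ℝ) + 1 ≠ 0 := by positivity
  ext j
  rw [centeredData_apply]
  simp only [dataMatrix, newPoint, Matrix.of_apply, Fin.val_last, lt_irrefl, if_false,
    Pi.smul_apply, smul_eq_mul]
  field_simp
  ring

/-- The covariance matrix of the augmented sample is a rank one perturbation of the one of the
calibration sample. -/
theorem ridgeCov_eq (hn : 0 < n) (lam : ℝ) (z : EuclideanSpace ℝ (Fin l)) :
    ridgeCov n lam x r z = calibCov n lam x r +
      ((n : ℝ) + 1)⁻¹ • vecMulVec (newPoint n x r z) (newPoint n x r z) := by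
  have hn' : (n : ℝ) ≠ 0 := by positivity
  have hn1 : (n : ℝ) + 1 ≠ 0 := by positivity
  ext a b
  -- The cross terms vanish because the calibration rows sum to zero. With `c = 1 / (n + 1)`, the
  -- rank one coefficient is then `(n c² + (1 - c)²) / n = c`.
  have hsum : ∑ i : Fin n, (calibMatrix n x r i a - ((n : ℝ) + 1)⁻¹ * newPoint n x r z a) *
      (calibMatrix n x r i b - ((n : ℝ) + 1)⁻¹ * newPoint n x r z b) =
      ∑ i : Fin n, calibMatrix n x r i a * calibMatrix n x r i b +
        n * (((n : ℝ) + 1)⁻¹ ^ 2 * newPoint n x r z a * newPoint n x r z b) := by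
    have h : ∀ i : Fin n, (calibMatrix n x r i a - ((n : ℝ) + 1)⁻¹ * newPoint n x r z a) *
        (calibMatrix n x r i b - ((n : ℝ) + 1)⁻¹ * newPoint n x r z b) =
        calibMatrix n x r i a * calibMatrix n x r i b
        - calibMatrix n x r i a * (((n : ℝ) + 1)⁻¹ * newPoint n x r z b)
        - calibMatrix n x r i b * (((n : ℝ) + 1)⁻¹ * newPoint n x r z a) +
        ((n : ℝ) + 1)⁻¹ ^ 2 * newPoint n x r z a * newPoint n x r z b := fun i => by ring
    simp only [h, Finset.sum_add_distrib, Finset.sum_sub_distrib, ← Finset.sum_mul,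
      sum_calibMatrix]
    simp only [zero_mul, sub_zero, Finset.sum_const, Finset.card_univ, Fintype.card_fin,
      nsmul_eq_mul]
    ring
  simp only [ridgeCov, calibCov, Matrix.add_apply, Matrix.smul_apply, Matrix.mul_apply,
    Matrix.transpose_apply, Fin.sum_univ_castSucc, centeredData_castSucc x r hn,
    centeredData_last x r hn, Pi.sub_apply, Pi.smul_apply, smul_eq_mul, vecMulVec_apply, hsum]
  field_simp
  ring

theorem posSemidef_transpose_mul_calibMatrix :
    ((calibMatrix n x r)ᵀ * calibMatrix n x r).PosSemidef := by
  simpa using posSemidef_conjTranspose_mul_self (calibMatrix n x r)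

theorem posDef_smul_one {ι : Type*} [Fintype ι] [DecidableEq ι] {c : ℝ} (hc : 0 < c) :
    (c • (1 : Matrix ι ι ℝ)).PosDef :=
  Matrix.PosDef.one.smul hc

theorem posDef_calibCov {lam : ℝ} (hlam : 0 < lam) : (calibCov n lam x r).PosDef :=
  Matrix.PosDef.posSemidef_add
    ((posSemidef_transpose_mul_calibMatrix x r).smul (by positivity)) (posDef_smul_one hlam)

theorem posDef_ridgeCov {lam : ℝ} (hlam : 0 < lam) (z : EuclideanSpace ℝ (Fin l)) :
    (ridgeCov n lam x r z).PosDef := by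
  have h : ((centeredData n x r z)ᵀ * centeredData n x r z).PosSemidef := by
    simpa using posSemidef_conjTranspose_mul_self (centeredData n x r z)
  exact Matrix.PosDef.posSemidef_add (h.smul (by positivity)) (posDef_smul_one hlam)

theorem transpose_mul_calibMatrix_add (hn : 0 < n) (lam : ℝ) :
    (calibMatrix n x r)ᵀ * calibMatrix n x r + ((n : ℝ) * lam) • 1 =
      (n : ℝ) • calibCov n lam x r := by
  have hn' : (n : ℝ) ≠ 0 := by positivity
  rw [calibCov, smul_add, smul_smul, smul_smul, mul_inv_cancel₀ hn', one_smul]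

theorem ridgeProj_diag (hn : 0 < n) {lam : ℝ} (hlam : 0 < lam) (i : Fin n) :
    (n : ℝ) * ridgeProj n lam x r i i =
      calibMatrix n x r i ⬝ᵥ ((calibCov n lam x r)⁻¹ *ᵥ calibMatrix n x r i) := by
  have hn' : (n : ℝ) ≠ 0 := by positivity
  have hdet : IsUnit (calibCov n lam x r).det :=
    (isUnit_iff_isUnit_det _).mp (posDef_calibCov x r hlam).isUnit
  have hinv : ((n : ℝ) • calibCov n lam x r)⁻¹ = (n : ℝ)⁻¹ • (calibCov n lam x r)⁻¹ :=
    inv_smul' _ (Units.mk0 (n : ℝ) hn') hdet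
  rw [ridgeProj, transpose_mul_calibMatrix_add x r hn, hinv, Matrix.mul_smul, Matrix.smul_mul,
    Matrix.smul_apply, smul_eq_mul, mul_inv_cancel_left₀ hn', Matrix.mul_assoc, mul_apply']
  congr 1

theorem ridgeProj_diag_nonneg (hn : 0 < n) {lam : ℝ} (hlam : 0 < lam) (i : Fin n) :
    0 ≤ ridgeProj n lam x r i i := by
  have h := quadForm_nonneg (posDef_calibCov x r hlam (n := n)).inv.posSemidef (calibMatrix n x r i)
  rw [← ridgeProj_diag x r hn hlam] at h
  exact nonneg_of_mul_nonneg_right h (by positivity)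

/-- The leverages sum up to at most the dimension. -/
theorem sum_ridgeProj_diag_le (hn : 0 < n) {lam : ℝ} (hlam : 0 < lam) :
    ∑ i, ridgeProj n lam x r i i ≤ (k : ℝ) + l := by
  set G := (calibMatrix n x r)ᵀ * calibMatrix n x r + ((n : ℝ) * lam) • 1 with hG
  have hGpos : G.PosDef := Matrix.PosDef.posSemidef_add
    (posSemidef_transpose_mul_calibMatrix x r) (posDef_smul_one (by positivity))
  have hdet : IsUnit G.det := (isUnit_iff_isUnit_det _).mp hGpos.isUnit
  have h1 : (calibMatrix n x r)ᵀ * calibMatrix n x r = G - ((n : ℝ) * lam) • 1 := by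
    rw [hG, add_sub_cancel_right]
  have h2 : ∑ i, ridgeProj n lam x r i i = (ridgeProj n lam x r).trace := rfl
  -- Cyclicity of the trace turns the sum into `p - n lam tr G⁻¹`.
  rw [h2, ridgeProj, ← hG, trace_mul_comm, ← Matrix.mul_assoc, h1, Matrix.sub_mul,
    mul_nonsing_inv _ hdet, trace_sub, trace_one, Matrix.smul_mul, Matrix.one_mul, trace_smul]
  have h3 : 0 ≤ ((n : ℝ) * lam) • G⁻¹.trace :=
    smul_nonneg (by positivity) hGpos.inv.posSemidef.trace_nonneg
  simp only [Fintype.card_sum, Fintype.card_fin, Nat.cast_add]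
  linarith

theorem qStat_nonneg (hn : 0 < n) (α : ℝ) {lam : ℝ} (hlam : 0 < lam) :
    0 ≤ qStat n α lam x r :=
  mul_nonneg (by positivity) (orderStat_nonneg (ridgeProj_diag_nonneg x r hn hlam) _)

theorem one_le_confRank {α : ℝ} (hα1 : α < 1) (n : ℕ) : 1 ≤ confRank n α :=
  Nat.one_le_ceil_iff.mpr (mul_pos (by linarith) (by positivity))

theorem confRank_lt {α : ℝ} (hα1 : α < 1) (n : ℕ) :
    (confRank n α : ℝ) < (1 - α) * ((n : ℝ) + 1) + 1 :=
  Nat.ceil_lt_add_one (mul_nonneg (by linarith) (by positivity))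

/-- `q_{n,α}` is bounded by a constant, whatever the sample. -/
theorem qStat_le {α lam : ℝ} (hα0 : 0 < α) (hα1 : α < 1) (hlam : 0 < lam) (hn : 2 ≤ α * n) :
    qStat n α lam x r ≤ 2 * (k + l) / α := by
  have hn0 : 0 < n := by
    rcases Nat.eq_zero_or_pos n with rfl | h
    · norm_num at hn
    · exact h
  have hc := confRank_lt hα1 n
  have hle : confRank n α ≤ n := by
    have : (confRank n α : ℝ) < n + 1 := by nlinarith
    exact Nat.lt_succ_iff.mp (by exact_mod_cast this)
  have h1 := orderStat_mul_le_sum (ridgeProj_diag_nonneg x r hn0 hlam) (one_le_confRank hα1 n) hle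
  have h2 := h1.trans (sum_ridgeProj_diag_le x r hn0 hlam)
  have h0 := orderStat_nonneg (ridgeProj_diag_nonneg x r hn0 hlam) (confRank n α)
  rw [le_div_iff₀ hα0, qStat]
  -- The ceiling leaves more than `α n - 1 + α` entries at or above the order statistic, and `1 ≤ α
  -- n / 2`.
  have h3 : α * n / 2 ≤ (n : ℝ) - confRank n α + 1 := by linarith
  have h4 := mul_le_mul_of_nonneg_right h3 h0
  linarith

/-- Off the conformal set the Mahalanobis norm of the new point exceeds `q_{n,α}`. -/
theorem qStat_lt_of_notMem_conformalSet {α lam : ℝ} (hα1 : α < 1) (hlam : 0 < lam) (hn : 0 < n)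
    (hle : confRank n α ≤ n) {z : EuclideanSpace ℝ (Fin l)}
    (hz : z ∉ conformalSet n α lam x r) :
    qStat n α lam x r <
      newPoint n x r z ⬝ᵥ ((calibCov n lam x r)⁻¹ *ᵥ newPoint n x r z) := by
  obtain ⟨i, hi1, hi2⟩ := exists_orderStat_le_and_le_orderStat
    (fun i : Fin n => ridgeProj n lam x r i i)
    (fun i : Fin n => score n lam x r z i.castSucc) (one_le_confRank hα1 n) hle
  have hlt : score n lam x r z i.castSucc < score n lam x r z (Fin.last n) :=
    hi2.trans_lt (not_le.mp hz)
  have hn1 : (1 : ℝ) < (n : ℝ) + 1 := by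
    have : (0 : ℝ) < n := by exact_mod_cast hn
    linarith
  rw [score, score, centeredData_castSucc x r hn, centeredData_last x r hn, mulVec_smul,
    smul_dotProduct, dotProduct_smul, smul_eq_mul, smul_eq_mul, ← mul_assoc, ← sq] at hlt
  have hT := posDef_ridgeCov x r hlam z (n := n)
  have h1 := quadForm_lt_of_sub_smul_lt hT.inv.posSemidef _ _ (by positivity)
    (inv_lt_one_of_one_lt₀ hn1) hlt
  have h2 := inv_quadForm_lt_of_rank_one (posDef_calibCov x r hlam) hT _ _ (by positivity)
    (ridgeCov_eq x r hn lam z) h1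
  rw [← ridgeProj_diag x r hn hlam] at h2
  refine lt_of_le_of_lt ?_ h2
  exact mul_le_mul_of_nonneg_left hi1 (by positivity)

theorem inv_quadForm_newPoint {lam : ℝ} (hlam : 0 < lam) (z : EuclideanSpace ℝ (Fin l)) :
    newPoint n x r z ⬝ᵥ ((calibCov n lam x r)⁻¹ *ᵥ newPoint n x r z) =
      (z.ofLp - center n lam x r) ⬝ᵥ ((shape n lam x r)⁻¹ *ᵥ (z.ofLp - center n lam x r)) +
        newInput n x ⬝ᵥ ((calibCov n lam x r).toBlocks₁₁⁻¹ *ᵥ newInput n x) := by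
  rw [newPoint_eq_sumElim, inv_quadForm_sumElim (posDef_calibCov x r hlam)]
  have h : z.ofLp - (empMean n r).ofLp - ((calibCov n lam x r).toBlocks₂₁ *
      (calibCov n lam x r).toBlocks₁₁⁻¹) *ᵥ newInput n x = z.ofLp - center n lam x r := by
    rw [center]; abel
  rw [h]
  rfl

/-- The part of the ellipsoid outside the conformal set lies in an ellipsoidal shell. -/
theorem ellipsoid_diff_conformalSet_subset {α lam : ℝ} (hα1 : α < 1) (hlam : 0 < lam) (hn : 0 < n)
    (hle : confRank n α ≤ n) (hq : qStat n α lam x r < n - 1) :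
    ellipsoid n α lam x r \ conformalSet n α lam x r ⊆
      {z | qStat n α lam x r - newInput n x ⬝ᵥ
          ((calibCov n lam x r).toBlocks₁₁⁻¹ *ᵥ newInput n x) <
          (z.ofLp - center n lam x r) ⬝ᵥ ((shape n lam x r)⁻¹ *ᵥ (z.ofLp - center n lam x r)) ∧
        (z.ofLp - center n lam x r) ⬝ᵥ ((shape n lam x r)⁻¹ *ᵥ (z.ofLp - center n lam x r)) ≤
          sqRadius n α lam x r} := by
  rintro z ⟨hz1, hz2⟩
  rw [ellipsoid, if_neg (not_le.mpr hq)] at hz1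
  have h := qStat_lt_of_notMem_conformalSet x r hα1 hlam hn hle hz2
  rw [inv_quadForm_newPoint x r hlam] at h
  exact ⟨by linarith, hz1⟩

theorem sum_sub_mean_sq_le (a : Fin n → ℝ) :
    ∑ i, (a i - (n : ℝ)⁻¹ * ∑ s, a s) ^ 2 ≤ ∑ i, a i ^ 2 := by
  rcases Nat.eq_zero_or_pos n with rfl | hn
  · simp
  have hn' : (n : ℝ) ≠ 0 := by positivity
  have h : ∑ i, (a i - (n : ℝ)⁻¹ * ∑ s, a s) ^ 2 = ∑ i, a i ^ 2 - (n : ℝ)⁻¹ * (∑ s, a s) ^ 2 := by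
    simp only [sub_sq, Finset.sum_add_distrib, Finset.sum_sub_distrib, ← Finset.sum_mul,
      ← Finset.mul_sum, Finset.sum_const, Finset.card_univ, Fintype.card_fin, nsmul_eq_mul]
    field_simp
    ring
  rw [h]
  have : 0 ≤ (n : ℝ)⁻¹ * (∑ s, a s) ^ 2 := by positivity
  linarith

/-- The calibration covariance matrix is bounded by the empirical second moment. -/
theorem calibCov_quadForm_le (lam : ℝ) (u : Fin k ⊕ Fin l → ℝ) :
    u ⬝ᵥ (calibCov n lam x r *ᵥ u) ≤
      ((n : ℝ)⁻¹ * ∑ i : Fin n, ‖stack (x i) (r i)‖ ^ 2 + lam) * (u ⬝ᵥ u) := by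
  have h1 : u ⬝ᵥ (((calibMatrix n x r)ᵀ * calibMatrix n x r) *ᵥ u) =
      ∑ i, (calibMatrix n x r i ⬝ᵥ u) ^ 2 := by
    rw [← mulVec_mulVec, dotProduct_mulVec, vecMul_transpose]
    simp [dotProduct, mulVec, sq]
  have h2 : ∀ i, calibMatrix n x r i ⬝ᵥ u = (stack (x i) (r i)).ofLp ⬝ᵥ u -
      (n : ℝ)⁻¹ * ∑ s : Fin n, (stack (x s) (r s)).ofLp ⬝ᵥ u := by
    intro i
    simp only [dotProduct, calibMatrix, Matrix.of_apply, sub_mul, Finset.sum_sub_distrib]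
    rw [Finset.sum_comm, Finset.mul_sum]
    simp only [mul_assoc, Finset.sum_mul]
  have h3 : ∀ i : Fin n, ((stack (x i) (r i)).ofLp ⬝ᵥ u) ^ 2 ≤
      ‖stack (x i) (r i)‖ ^ 2 * (u ⬝ᵥ u) := by
    intro i
    rw [EuclideanSpace.real_norm_sq_eq]
    simp only [dotProduct, ← sq]
    exact Finset.sum_mul_sq_le_sq_mul_sq _ _ _
  have h4 : ∑ i, (calibMatrix n x r i ⬝ᵥ u) ^ 2 ≤
      (∑ i : Fin n, ‖stack (x i) (r i)‖ ^ 2) * (u ⬝ᵥ u) := by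
    simp only [h2]
    refine (sum_sub_mean_sq_le fun i : Fin n => (stack (x i) (r i)).ofLp ⬝ᵥ u).trans ?_
    rw [Finset.sum_mul]
    exact Finset.sum_le_sum fun i _ => h3 i
  rw [calibCov, add_mulVec, dotProduct_add, smul_mulVec, smul_mulVec, dotProduct_smul,
    dotProduct_smul, one_mulVec, h1, smul_eq_mul, smul_eq_mul, add_mul, mul_assoc]
  have := mul_le_mul_of_nonneg_left h4 (show 0 ≤ (n : ℝ)⁻¹ by positivity)
  linarith

/-- The inverse of the Schur complement is the lower right block of the inverse covariance, so
testing on vectors `(0, u)` transfers the bound. -/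
theorem dotProduct_self_le_mul_shape_inv {lam : ℝ} (hlam : 0 < lam) (u : Fin l → ℝ) :
    u ⬝ᵥ u ≤ ((n : ℝ)⁻¹ * ∑ i : Fin n, ‖stack (x i) (r i)‖ ^ 2 + lam) *
      (u ⬝ᵥ ((shape n lam x r)⁻¹ *ᵥ u)) := by
  have h := dotProduct_self_le_mul_inv_quadForm (posDef_calibCov x r hlam)
    (calibCov_quadForm_le x r lam (n := n)) (Sum.elim 0 u)
  rw [inv_quadForm_sumElim (posDef_calibCov x r hlam), sumElim_dotProduct_sumElim] at h
  simpa [shape] using h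

end Sample

/-! ### Volume of ellipsoidal shells -/

section Shell

open Pointwise

theorem sublevel_subset_closedBall {E : Type*} [NormedAddCommGroup E] {Q : E → ℝ} {τ : ℝ} (hτ : 0 ≤ τ)
    (hQτ : ∀ u, ‖u‖ ^ 2 ≤ τ * Q u) (s : ℝ) :
    {u | Q u ≤ s} ⊆ Metric.closedBall 0 √(τ * s) := by
  intro u hu
  rw [mem_closedBall_zero_iff]
  exact Real.le_sqrt_of_sq_le ((hQτ u).trans (mul_le_mul_of_nonneg_left hu hτ))

variable {E : Type*} [NormedAddCommGroup E] [NormedSpace ℝ E] [MeasurableSpace E] [BorelSpace E]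
  [FiniteDimensional ℝ E] (μ : Measure E) [μ.IsAddHaarMeasure]

/-- Homogeneity makes the sublevel set a dilate by `√s` of the unit one. At `s = 0` it is within a
single point, null in positive dimension. -/
theorem measureReal_sublevel {Q : E → ℝ} {τ : ℝ} (hτ : 0 ≤ τ)
    (hQs : ∀ (c : ℝ) u, Q (c • u) = c ^ 2 * Q u)
    (hQτ : ∀ u, ‖u‖ ^ 2 ≤ τ * Q u) (hd : Module.finrank ℝ E ≠ 0) {s : ℝ} (hs : 0 ≤ s) :
    μ.real {u | Q u ≤ s} = √s ^ Module.finrank ℝ E * μ.real {u | Q u ≤ 1} := by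
  have key : μ.real (√s • {u | Q u ≤ 1}) =
      √s ^ Module.finrank ℝ E * μ.real {u | Q u ≤ 1} := by
    rw [measureReal_def, Measure.addHaar_smul, ENNReal.toReal_mul,
      ENNReal.toReal_ofReal (abs_nonneg _),
      abs_of_nonneg (by positivity), ← measureReal_def]
  rcases hs.eq_or_lt with rfl | hs
  · rw [Real.sqrt_zero, zero_pow hd, zero_mul]
    have h : μ {u | Q u ≤ 0} ≤ μ {0} := by
      refine measure_mono ((sublevel_subset_closedBall hτ hQτ 0).trans ?_)
      simp
    have : Nontrivial E := Module.nontrivial_of_finrank_pos (R := ℝ) (Nat.pos_of_ne_zero hd)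
    rw [measureReal_def, le_antisymm (h.trans_eq (measure_singleton 0)) zero_le, ENNReal.toReal_zero]
  · rw [← key]
    congr 1
    ext u
    rw [Set.mem_smul_set_iff_inv_smul_mem₀ (Real.sqrt_pos.mpr hs).ne']
    simp only [Set.mem_ofPred_eq, hQs, inv_pow, Real.sq_sqrt hs.le]
    rw [inv_mul_le_iff₀ hs, mul_one]

/-- The bound is uniform in `t`, which may be negative. The radii satisfy `√(t + δ) - √t ≤ √δ`, even
near `t = 0` where the square root is not Lipschitz. -/
theorem measureReal_shell_le {Q : E → ℝ} (hQ : Continuous Q) {τ : ℝ} (hτ : 0 ≤ τ)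
    (hQs : ∀ (c : ℝ) u, Q (c • u) = c ^ 2 * Q u)
    (hQτ : ∀ u, ‖u‖ ^ 2 ≤ τ * Q u) (hd : Module.finrank ℝ E ≠ 0) {t δ C : ℝ} (hδ : 0 ≤ δ)
    (hδC : δ ≤ C) (htC : t + δ ≤ C) (z₀ : E) :
    μ.real {z | t < Q (z - z₀) ∧ Q (z - z₀) ≤ t + δ} ≤
      √δ * Module.finrank ℝ E * √C ^ (Module.finrank ℝ E - 1) *
        μ.real (Metric.closedBall (0 : E) √τ) := by
  set d := Module.finrank ℝ E
  have hfin : ∀ s, μ {u | Q u ≤ s} ≠ ⊤ := fun s =>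
    ne_top_of_le_ne_top (measure_closedBall_lt_top (x := (0 : E)) (r := √(τ * s))).ne
      (measure_mono (sublevel_subset_closedBall hτ hQτ s))
  have hball : μ.real {u | Q u ≤ 1} ≤ μ.real (Metric.closedBall (0 : E) √τ) := by
    refine measureReal_mono ?_ measure_closedBall_lt_top.ne
    simpa using sublevel_subset_closedBall hτ hQτ 1
  have htrans : μ.real {z | t < Q (z - z₀) ∧ Q (z - z₀) ≤ t + δ} =
      μ.real {u | t < Q u ∧ Q u ≤ t + δ} := by
    have h := measure_preimage_add_right μ (-z₀) {u | t < Q u ∧ Q u ≤ t + δ}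
    simp only [← sub_eq_add_neg] at h
    exact congrArg ENNReal.toReal h
  have hpow : ∀ {a b : ℝ}, 0 ≤ a → a ≤ b → b - a ≤ √δ → b ≤ √C →
      b ^ d - a ^ d ≤ √δ * d * √C ^ (d - 1) := by
    intro a b ha hab hba hbC
    have h := abs_pow_sub_pow_le b a d
    rw [abs_of_nonneg (sub_nonneg.mpr hab), abs_of_nonneg ha, abs_of_nonneg (ha.trans hab),
      max_eq_left hab] at h
    refine (le_abs_self _).trans (h.trans ?_)
    have : 0 ≤ b := ha.trans hab
    gcongr
  have hB : 0 ≤ μ.real {u | Q u ≤ 1} := measureReal_nonneg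
  rw [htrans]
  suffices h : μ.real {u | t < Q u ∧ Q u ≤ t + δ} ≤
      (√δ * d * √C ^ (d - 1)) * μ.real {u | Q u ≤ 1} from
    h.trans (mul_le_mul_of_nonneg_left hball (by positivity))
  rcases le_or_gt 0 t with ht | ht
  · have hset : {u | t < Q u ∧ Q u ≤ t + δ} = {u | Q u ≤ t + δ} \ {u | Q u ≤ t} := by
      ext u; simp [and_comm]
    have hsub : {u | Q u ≤ t} ⊆ {u | Q u ≤ t + δ} := fun u (hu : Q u ≤ t) =>
      show Q u ≤ t + δ by linarith
    rw [hset, measureReal_sdiff hsub (measurableSet_le hQ.measurable measurable_const) (hfin _),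
      measureReal_sublevel μ hτ hQs hQτ hd ht,
      measureReal_sublevel μ hτ hQs hQτ hd (add_nonneg ht hδ), ← sub_mul]
    refine mul_le_mul_of_nonneg_right (hpow (Real.sqrt_nonneg _)
      (Real.sqrt_le_sqrt (by linarith)) ?_ (Real.sqrt_le_sqrt htC)) hB
    have h : √(t + δ) ≤ √t + √δ := by
      rw [Real.sqrt_le_left (by positivity)]
      nlinarith [Real.sq_sqrt ht, Real.sq_sqrt hδ, Real.sqrt_nonneg t, Real.sqrt_nonneg δ]
    linarith
  -- For negative `t` the shell lies in the solid ellipsoid `Q ≤ δ`.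
  · have hset : {u | t < Q u ∧ Q u ≤ t + δ} ⊆ {u | Q u ≤ δ} := fun u hu =>
      show Q u ≤ δ by linarith [hu.2]
    refine (measureReal_mono hset (hfin _)).trans ?_
    rw [measureReal_sublevel μ hτ hQs hQτ hd hδ]
    have h := hpow le_rfl (Real.sqrt_nonneg δ) (sub_zero _).le (Real.sqrt_le_sqrt hδC)
    rw [zero_pow hd, sub_zero] at h
    exact mul_le_mul_of_nonneg_right h hB

end Shell

/-! ### The volume bound and convergence in probability -/

section Bound

variable {k l n : ℕ} (x : ℕ → EuclideanSpace ℝ (Fin k)) (r : ℕ → EuclideanSpace ℝ (Fin l))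

/-- The width of the shell `q < m ≤ (q + 1) / (1 - (q + 1) / n) - 1` is of order `1 / n`. -/
theorem shell_width_le {q b N : ℝ} (hq0 : 0 ≤ q) (hqb : q ≤ b) (hN : 2 * (b + 1) ≤ N) :
    (q + 1) / (1 - (q + 1) / N) - 1 ≤ q + 2 * (b + 1) ^ 2 / N := by
  have hNpos : 0 < N := by linarith
  have h1 : (q + 1) / N ≤ 1 / 2 := by
    rw [div_le_iff₀ hNpos]; linarith
  have h2 : 0 < 1 - (q + 1) / N := by linarith
  -- This is `1 / (1 - y) ≤ 1 + 2 y` for `y = (q + 1) / N ≤ 1 / 2`.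
  have h3 : (q + 1) / (1 - (q + 1) / N) ≤ (q + 1) + 2 * (q + 1) ^ 2 / N := by
    rw [div_le_iff₀ h2]
    have h4 : 0 ≤ (q + 1) ^ 2 / N * (1 - 2 * ((q + 1) / N)) :=
      mul_nonneg (by positivity) (by linarith)
    have h5 : ((q + 1) + 2 * (q + 1) ^ 2 / N) * (1 - (q + 1) / N) =
        (q + 1) + (q + 1) ^ 2 / N * (1 - 2 * ((q + 1) / N)) := by
      field_simp
      ring
    linarith
  have h6 : 2 * (q + 1) ^ 2 / N ≤ 2 * (b + 1) ^ 2 / N := by gcongr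
  linarith

/-- A bound for the volume of the part of the ellipsoid outside the conformal set in terms of the
empirical second moment of the sample. -/
theorem volume_ellipsoid_diff_conformalSet_le (hl : 1 ≤ l) {α lam M : ℝ} (hα0 : 0 < α) (hα1 : α < 1)
    (hlam : 0 < lam) (hn1 : 2 ≤ α * n) (hn2 : 2 * (2 * (k + l) / α + 1) ≤ n)
    (hM : (n : ℝ)⁻¹ * ∑ i : Fin n, ‖stack (x i) (r i)‖ ^ 2 ≤ M)
    (K : Set (EuclideanSpace ℝ (Fin l))) :
    volume.real ((ellipsoid n α lam x r \ conformalSet n α lam x r) ∩ K) ≤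
      √(2 * (2 * (k + l) / α + 1) ^ 2 / n) * l *
        √(2 * (k + l) / α + 2 * (2 * (k + l) / α + 1) ^ 2) ^ (l - 1) *
        volume.real (Metric.closedBall (0 : EuclideanSpace ℝ (Fin l)) √(M + lam)) := by
  have hb : (0 : ℝ) ≤ 2 * (k + l) / α := by positivity
  have hqb := qStat_le x r hα0 hα1 hlam hn1
  generalize (2 * (k + l) / α : ℝ) = b at *
  have hnpos : (0 : ℝ) < n := by linarith
  have hn : 0 < n := by exact_mod_cast hnpos
  have hq0 := qStat_nonneg x r hn α hlam
  have hle : confRank n α ≤ n := by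
    have hc := confRank_lt hα1 n
    have : (confRank n α : ℝ) < n + 1 := by nlinarith
    exact Nat.lt_succ_iff.mp (by exact_mod_cast this)
  have hsub := ellipsoid_diff_conformalSet_subset x r hα1 hlam hn hle (by linarith)
  set c := newInput n x ⬝ᵥ ((calibCov n lam x r).toBlocks₁₁⁻¹ *ᵥ newInput n x) with hc
  have hc0 : 0 ≤ c := quadForm_nonneg
    ((posDef_calibCov x r hlam).submatrix (e := Sum.inl) Sum.inl_injective).inv.posSemidef _
  set z₀ : EuclideanSpace ℝ (Fin l) := WithLp.toLp 2 (center n lam x r)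
  set Q : EuclideanSpace ℝ (Fin l) → ℝ := fun u => u.ofLp ⬝ᵥ ((shape n lam x r)⁻¹ *ᵥ u.ofLp) with hQ
  have hwidth := shell_width_le hq0 hqb hn2
  set δ := 2 * (b + 1) ^ 2 / n with hδ
  have hδ0 : 0 ≤ δ := by positivity
  have hδ1 : δ ≤ 2 * (b + 1) ^ 2 := div_le_self (by positivity) (by exact_mod_cast hn)
  have hM0 : 0 ≤ M := le_trans (by positivity) hM
  have hQ0 : ∀ u, ‖u‖ ^ 2 ≤ ((n : ℝ)⁻¹ * ∑ i : Fin n, ‖stack (x i) (r i)‖ ^ 2 + lam) * Q u := by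
    intro u
    rw [EuclideanSpace.real_norm_sq_eq]
    simpa only [hQ, dotProduct, sq] using dotProduct_self_le_mul_shape_inv x r hlam u.ofLp (n := n)
  have hQτ : ∀ u, ‖u‖ ^ 2 ≤ (M + lam) * Q u := by
    intro u
    have hpos : 0 < (n : ℝ)⁻¹ * ∑ i : Fin n, ‖stack (x i) (r i)‖ ^ 2 + lam := by positivity
    have h0 : 0 ≤ Q u := nonneg_of_mul_nonneg_right ((sq_nonneg _).trans (hQ0 u)) hpos
    exact (hQ0 u).trans (mul_le_mul_of_nonneg_right (by linarith) h0)
  have hQcont : Continuous Q := by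
    simp only [hQ, dotProduct, mulVec]
    fun_prop
  have hQs : ∀ (a : ℝ) u, Q (a • u) = a ^ 2 * Q u := by
    intro a u
    simp only [hQ, WithLp.ofLp_smul, mulVec_smul, dotProduct_smul, smul_dotProduct, smul_eq_mul]
    ring
  have hd : Module.finrank ℝ (EuclideanSpace ℝ (Fin l)) = l := by simp
  -- `C` does not depend on the sample: `t + δ ≤ b + δ` since `c ≥ 0`, and `δ ≤ 2 (b + 1)²` since `n
  -- ≥ 1`.
  have hshell := measureReal_shell_le volume hQcont (by linarith : 0 ≤ M + lam) hQs hQτ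
    (by rw [hd]; omega) (t := qStat n α lam x r - c) (C := b + 2 * (b + 1) ^ 2) hδ0
    (by linarith) (by linarith) z₀
  rw [hd] at hshell
  have hsub' : (ellipsoid n α lam x r \ conformalSet n α lam x r) ∩ K ⊆
      {z | qStat n α lam x r - c < Q (z - z₀) ∧ Q (z - z₀) ≤ qStat n α lam x r - c + δ} := by
    rintro z ⟨hz, -⟩
    obtain ⟨h1, h2⟩ := hsub hz
    refine ⟨h1, h2.trans ?_⟩
    rw [sqRadius, ← hc]
    linarith
  refine (measureReal_mono hsub' ?_).trans hshell
  -- `volume.real` is monotone only into a set of finite measure, so the shell must be seen to be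
  -- bounded.
  have hbdd : {z | qStat n α lam x r - c < Q (z - z₀) ∧ Q (z - z₀) ≤ qStat n α lam x r - c + δ} ⊆
      Metric.closedBall z₀ √((M + lam) * (qStat n α lam x r - c + δ)) := by
    intro z hz
    have h := sublevel_subset_closedBall (by linarith : 0 ≤ M + lam) hQτ _ hz.2
    rwa [mem_closedBall_zero_iff, ← mem_closedBall_iff_norm] at h
  exact ne_top_of_le_ne_top measure_closedBall_lt_top.ne (measure_mono hbdd)

end Bound

/-- Markov's inequality for an empirical mean of nonnegative identically distributed variables. -/
theorem measureReal_le_empirical_mean {Ω : Type*} [MeasurableSpace Ω] (P : Measure Ω)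
    {T : ℕ → Ω → ℝ} (hT0 : ∀ i ω, 0 ≤ T i ω)
    (hident : ∀ i, IdentDistrib (T i) (T 0) P P) (hint : Integrable (T 0) P) {n : ℕ} (hn : 0 < n)
    {M : ℝ} (hM : 0 < M) :
    P.real {ω | M ≤ (n : ℝ)⁻¹ * ∑ i : Fin n, T i ω} ≤ (∫ ω, T 0 ω ∂P) / M := by
  have hn' : (n : ℝ) ≠ 0 := by positivity
  have hi : ∀ i, Integrable (T i) P := fun i => (hident i).integrable_iff.mpr hint
  have h := mul_meas_ge_le_integral_of_nonneg (μ := P)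
    (f := fun ω => (n : ℝ)⁻¹ * ∑ i : Fin n, T i ω)
    (Eventually.of_forall fun ω => mul_nonneg (by positivity)
      (Finset.sum_nonneg fun i _ => hT0 i ω))
    ((integrable_finsetSum Finset.univ fun (i : Fin n) _ => hi i).const_mul _) M
  rw [integral_const_mul, integral_finsetSum _ fun (i : Fin n) _ => hi i] at h
  simp only [fun i => (hident i).integral_eq, Finset.sum_const, Finset.card_univ, Fintype.card_fin,
    nsmul_eq_mul, inv_mul_cancel_left₀ hn'] at h
  rw [le_div_iff₀ hM]
  linarith

end ConformalEllipsoid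

theorem proposition3p4 {Ω : Type*} [MeasurableSpace Ω] (P : Measure Ω) [IsProbabilityMeasure P]
    {k l : ℕ} (hk : 1 ≤ k) (hl : 1 ≤ l)
    (X : ℕ → Ω → EuclideanSpace ℝ (Fin k)) (Y : ℕ → Ω → EuclideanSpace ℝ (Fin l))
    (f : EuclideanSpace ℝ (Fin k) → EuclideanSpace ℝ (Fin l))
    (R : ℕ → Ω → EuclideanSpace ℝ (Fin l)) (hR : ∀ i ω, R i ω = Y i ω - f (X i ω))
    (V : ℕ → Ω → EuclideanSpace ℝ (Fin k ⊕ Fin l))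
    (hV : ∀ i ω, V i ω = ConformalEllipsoid.stack (X i ω) (R i ω))
    (hindep : iIndepFun V P) (hident : ∀ i, IdentDistrib (V i) (V 0) P P)
    (α lam q : ℝ) (hα0 : 0 < α) (hα1 : α < 1) (hlam : 0 < lam) (hq : 1 < q)
    (hmoment : Integrable (fun ω => ‖V 0 ω‖ ^ (4 * q)) P)
    (K : Set (EuclideanSpace ℝ (Fin l))) (hK : IsCompact K) :
    TendstoInMeasure P
      (fun (n : ℕ) (ω : Ω) =>
        volume.real
          ((ConformalEllipsoid.ellipsoid n α lam (fun i => X i ω) (fun i => R i ω) \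
            ConformalEllipsoid.conformalSet n α lam (fun i => X i ω) (fun i => R i ω)) ∩ K))
      atTop (fun _ => (0 : ℝ)) := by
  have hident2 : ∀ i, IdentDistrib (fun ω => ‖V i ω‖ ^ 2) (fun ω => ‖V 0 ω‖ ^ 2) P P :=
    fun i => (hident i).norm.sq
  -- Domination by `1 + ‖V 0 ω‖ ^ (4 * q)`.
  have hint : Integrable (fun ω => ‖V 0 ω‖ ^ 2) P := by
    refine ((integrable_const (1 : ℝ)).add hmoment).mono'
      (hident2 0).aemeasurable_fst.aestronglyMeasurable (Eventually.of_forall fun ω => ?_)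
    rw [Real.norm_of_nonneg (by positivity), Pi.add_apply]
    rcases le_or_gt ‖V 0 ω‖ 1 with h | h
    · have h1 : ‖V 0 ω‖ ^ 2 ≤ 1 := pow_le_one₀ (norm_nonneg _) h
      have h2 : 0 ≤ ‖V 0 ω‖ ^ (4 * q) := by positivity
      linarith
    · have h1 : ‖V 0 ω‖ ^ (2 : ℝ) ≤ ‖V 0 ω‖ ^ (4 * q) :=
        Real.rpow_le_rpow_of_exponent_le h.le (by linarith)
      rw [Real.rpow_two] at h1
      linarith
  rw [tendstoInMeasure_iff_measureReal_norm]
  intro ε hε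
  rw [Metric.tendsto_atTop]
  intro η hη
  set D := ∫ ω, ‖V 0 ω‖ ^ 2 ∂P
  have hD : 0 ≤ D := integral_nonneg fun ω => by positivity
  -- Chosen so that Markov's bound `D / M = η D / (2 (D + 1))` is less than `η`.
  set M := 2 * (D + 1) / η with hMdef
  have hM : 0 < M := by positivity
  have hbound : Tendsto (fun n : ℕ => √(2 * (2 * (k + l) / α + 1) ^ 2 / n) * l *
      √(2 * (k + l) / α + 2 * (2 * (k + l) / α + 1) ^ 2) ^ (l - 1) *
      volume.real (Metric.closedBall (0 : EuclideanSpace ℝ (Fin l)) √(M + lam))) atTop (nhds 0) := by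
    have h := (tendsto_const_div_atTop_nhds_zero_nat (2 * (2 * (k + l) / α + 1 : ℝ) ^ 2)).sqrt
    rw [Real.sqrt_zero] at h
    simpa using ((h.mul_const (l : ℝ)).mul_const _).mul_const _
  have hlarge : ∀ c : ℝ, ∀ᶠ n : ℕ in atTop, c ≤ n := fun c =>
    tendsto_natCast_atTop_atTop.eventually_ge_atTop c
  obtain ⟨N, hN⟩ := eventually_atTop.mp ((hbound.eventually_lt_const hε).and
    ((hlarge (2 / α)).and ((hlarge (2 * (2 * (k + l) / α + 1))).and (eventually_gt_atTop 0))))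
  refine ⟨N, fun n hn => ?_⟩
  obtain ⟨h1, h2, h3, h4⟩ := hN n hn
  rw [div_le_iff₀' hα0] at h2
  rw [Real.dist_eq, sub_zero, abs_of_nonneg measureReal_nonneg]
  have hmarkov := ConformalEllipsoid.measureReal_le_empirical_mean P
    (fun i ω => sq_nonneg ‖V i ω‖) hident2 hint h4 hM
  refine lt_of_le_of_lt ((measureReal_mono ?_).trans hmarkov) ?_
  · intro ω hω
    -- If the empirical second moment is below `M`, the deterministic bound keeps the volume below
    -- `ε`.
    by_contra hlt
    rw [Set.mem_ofPred_eq, not_le] at hlt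
    simp only [hV] at hlt
    have h5 := ConformalEllipsoid.volume_ellipsoid_diff_conformalSet_le (fun i => X i ω)
      (fun i => R i ω) hl hα0 hα1 hlam h2 h3 hlt.le K
    rw [Set.mem_ofPred_eq, sub_zero, Real.norm_of_nonneg measureReal_nonneg] at hω
    linarith
  · rw [div_lt_iff₀ hM, hMdef, mul_div_cancel₀ _ hη.ne']
    linarith
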